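/- All structures and permutation groups have domain $\mathbb{N}$; $\mathrm{Sym}(\mathbb{N})$ carries the topology of pointwise convergence. Let $G\le \mathrm{Sym}(\mathbb{N})$ be a closed subgroup, and for finite $A\subseteq\mathbb{N}$ let $G_A$ be its pointwise stabilizer in $G$. The group $G$ is called *dynamically de Finetti* if 1. it has no algebraicity: for every finite $A\subseteq\mathbb{N}$, the set of points of $\mathbb{N}$ with finite $G_A$-orbit is $A$; 2. it weakly eliminates imaginaries: every open subgroup of $G$ contains some $G_A$, $A\subseteq \mathbb{N}$ finite, as a subgroup of finite index; 3. for every Borel action of $G$ on a standard Borel space $X$ with a $G$-invariant Borel probability measure $\mu$, and all finite $A,B\subseteq\mathbb{N}$, the $\sigma$-algebras $\mathcal{F}_A$ and $\mathcal{F}_B$ are conditionally independent over $\mathcal{F}_{A\cap B}$, where $\mathcal{F}_A$ is the $\sigma$-algebra generated by the measurable sets $Y\subseteq X$ with $\mu(Y\,\triangle\, gY)=0$ for all $g\in G_A$. The canonical language $\mathcal{L}_G$ has one $n$-ary relation symbol for each orbit of the diagonal action of $G$ on $\mathbb{N}^n$, $n\ge 1$; the canonical structure $\mathbf{M}_G$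 interprets each such symbol as the corresponding orbit. Let $\mathcal{L}=(R_i)_{i\in I}$ be a countable relational language containing $\mathcal{L}_G$, with $R_i$ of arity $r_i$. Let $\mathrm{Struc}_{\mathcal{L}}=\prod_{i\in I}\{0,1\}^{\mathbb{N}^{r_i}}$, on which $\mathrm{Sym}(\mathbb{N})$ acts by $R_i^{g\cdot\mathbf{M}}(\bar x)=R_i^{\mathbf{M}}(g^{-1}\bar x)$; $\mathrm{Aut}(\mathbf{M})$ is the stabilizer of $\mathbf{M}$ in $\mathrm{Sym}(\mathbb{N})$. Let $\mathrm{Struc}^G_{\mathcal{L}}\subseteq \mathrm{Struc}_{\mathcal{L}}$ be the closed, $G$-invariant set of those $\mathbf{M}$ whose $\mathcal{L}_G$-reduct is equal to $\mathbf{M}_G$. An invariant random expansion of $G$ is a $G$-invariant Borel probability measure $\mu$ on $\mathrm{Struc}^G_{\mathcal{L}}$. It is ergodic if every measurable $Y$ with $\mu(Y\,\triangle\, gY)=0$ for all $g\in G$ is null or conull. It has no fixed point if, for $\mu$-a.e. $\mathbf{M}$, no element of $\mathbb{N}$ is fixed by $\mathrm{Aut}(\mathbf{M})$. It is concentrated on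 an orbit if $\mu(O)=1$ for some orbit $O$ of $G$ on $\mathrm{Struc}^G_{\mathcal{L}}$. **Theorem.** Let $G$ be dynamically de Finetti, let $\mathcal{L}$ be a countable relational language containing $\mathcal{L}_G$, and let $\mu$ be an ergodic invariant random expansion of $G$ in the language $\mathcal{L}$. If $\mu$ has no fixed point, then $\mu$ is concentrated on an orbit. -/

import Mathlib

open MeasureTheory ProbabilityTheory
open scoped Pointwise

namespace RandomExpansion

/-! ### Permutation groups of `ℕ` -/

/-- The topology of pointwise convergence on `Sym(ℕ)` (with `ℕ` discrete). -/
instance permTopology : TopologicalSpace (Equiv.Perm ℕ) :=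
  TopologicalSpace.induced (fun g : Equiv.Perm ℕ => (g : ℕ → ℕ)) inferInstance

/-- The Borel σ-algebra of `Sym(ℕ)`. -/
instance permMeasurableSpace : MeasurableSpace (Equiv.Perm ℕ) := borel _

instance permBorelSpace : BorelSpace (Equiv.Perm ℕ) := ⟨rfl⟩

variable (G : Subgroup (Equiv.Perm ℕ))

/-- The pointwise stabilizer `G_A` of a finite set `A ⊆ ℕ`. -/
abbrev fixator (A : Finset ℕ) : Subgroup G := fixingSubgroup G (A : Set ℕ)

/-- The algebraic closure of `A`: the points lying in a finite orbit of `G_A`. -/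
def acl (A : Finset ℕ) : Set ℕ := {x | (MulAction.orbit (fixator G A) x).Finite}

/-- `G` has no algebraicity. -/
def NoAlgebraicity : Prop := ∀ A : Finset ℕ, acl G A = (A : Set ℕ)

/-- Weak elimination of imaginaries: every open subgroup of `G` contains the pointwise
stabilizer of some finite set as a subgroup of finite index. -/
def WeakElimImaginaries : Prop :=
  ∀ V : Subgroup G, IsOpen (V : Set G) →
    ∃ A : Finset ℕ, fixator G A ≤ V ∧ (fixator G A).IsFiniteRelIndex V

section Actions

variable {H : Type*} [Group H] {X : Type*} [MulAction H X]

/-- The σ-algebra generated by the measurable sets `Y` with `μ (Y ∆ gY) = 0` for all `g ∈ K`. -/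
@[reducible] def invariantSigma [MeasurableSpace X] (K : Subgroup H) (μ : Measure X) : MeasurableSpace X :=
  MeasurableSpace.generateFrom
    {Y : Set X | MeasurableSet Y ∧ ∀ g ∈ K, μ (symmDiff Y (g • Y)) = 0}

theorem invariantSigma_le [m : MeasurableSpace X] (K : Subgroup H) (μ : Measure X) :
    invariantSigma K μ ≤ m :=
  MeasurableSpace.generateFrom_le fun _ hY => hY.1

end Actions

/-- A closed subgroup `G` of `Sym(ℕ)` is dynamically de Finetti if it has no algebraicity, weakly
eliminates imaginaries and, for every Borel action of `G` on a standard Borel space `X` with an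
invariant probability measure and all finite `A, B ⊆ ℕ`, the σ-algebras `F_A` and `F_B` are
conditionally independent over `F_{A ∩ B}`. -/
structure IsDynamicallyDeFinetti : Prop where
  isClosed : IsClosed (G : Set (Equiv.Perm ℕ))
  noAlgebraicity : NoAlgebraicity G
  weakElimImaginaries : WeakElimImaginaries G
  condIndep : ∀ (X : Type) [MeasurableSpace X] [StandardBorelSpace X] [MulAction G X],
    Measurable (fun p : G × X => p.1 • p.2) →
    ∀ (μ : Measure X) [IsProbabilityMeasure μ] [SMulInvariantMeasure G X μ] (A B : Finset ℕ),
      CondIndep (invariantSigma (fixator G (A ∩ B)) μ)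
        (invariantSigma (fixator G A) μ) (invariantSigma (fixator G B) μ)
        (invariantSigma_le _ μ) μ

/-! ### Structures with domain `ℕ` and the logic action -/

/-- The space `∏ {0,1}^(ℕ^r)` of `L`-structures with domain `ℕ`, for a relational language `L`
(the product is over the relation symbols of `L`, sorted by their arity `r`). -/
def Struc (L : FirstOrder.Language.{0, 0}) : Type :=
  ∀ r : ℕ, L.Relations r → (Fin r → ℕ) → Bool

variable {L : FirstOrder.Language.{0, 0}}

/-- The product topology. -/
instance strucTopology : TopologicalSpace (Struc L) :=
  inferInstanceAs (TopologicalSpace (∀ r : ℕ, L.Relations r → (Fin r → ℕ) → Bool))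

/-- The product σ-algebra; for countable `L` it is the Borel σ-algebra, see `strucBorelSpace`. -/
instance strucMeasurableSpace : MeasurableSpace (Struc L) :=
  inferInstanceAs (MeasurableSpace (∀ r : ℕ, L.Relations r → (Fin r → ℕ) → Bool))

instance strucBorelSpace [∀ r, Countable (L.Relations r)] : BorelSpace (Struc L) :=
  inferInstanceAs (BorelSpace (∀ r : ℕ, L.Relations r → (Fin r → ℕ) → Bool))

/-- The logic action: `R^{g • M}(x₁,…,x_r) ↔ R^M(g⁻¹ x₁,…,g⁻¹ x_r)`. -/
instance logicAction : MulAction (Equiv.Perm ℕ) (Struc L) where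
  smul g M := fun r R x => M r R (fun i => g⁻¹ (x i))
  one_smul _ := rfl
  mul_smul g h M := by
    funext r R x
    change M r R _ = M r R _
    simp [mul_inv_rev]

theorem smul_apply (g : Equiv.Perm ℕ) (M : Struc L) (r : ℕ) (R : L.Relations r)
    (x : Fin r → ℕ) : (g • M) r R x = M r R (fun i => g⁻¹ (x i)) := rfl

/-- The automorphism group of `M`, i.e. its stabilizer in `Sym(ℕ)` for the logic action. -/
abbrev aut (M : Struc L) : Subgroup (Equiv.Perm ℕ) := MulAction.stabilizer (Equiv.Perm ℕ) M

/-! ### Expansions of the canonical structure -/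

/-- The canonical language of `G`: the relation symbols of arity `r ≥ 1` are the orbits of the
diagonal action of `G` on `ℕ^r`; there are no symbols of arity `0` and no function symbols. -/
def canonicalLanguage : FirstOrder.Language.{0, 0} where
  Functions _ := Empty
  Relations r := {j : Set (Fin r → ℕ) // 1 ≤ r ∧ ∃ x : Fin r → ℕ, j = MulAction.orbit G x}

open Classical in
/-- The canonical structure of `G`: the symbol given by the orbit `j` is interpreted as `j`. -/
noncomputable def canonicalStruc : Struc (canonicalLanguage G) :=
  fun _ j x => decide (x ∈ j.1)

/-- The reduct of an `L`-structure along an inclusion of languages. -/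
def reduct {L₀ : FirstOrder.Language.{0, 0}} (ι : L₀ →ᴸ L) (M : Struc L) : Struc L₀ :=
  fun _ R x => M _ (ι.onRelation R) x

theorem smul_canonicalStruc (g : G) : (g : Equiv.Perm ℕ) • canonicalStruc G = canonicalStruc G := by
  funext r j x
  rw [smul_apply]
  obtain ⟨j, hr, y, rfl⟩ := j
  simp only [canonicalStruc, decide_eq_decide]
  change g⁻¹ • x ∈ MulAction.orbit G y ↔ x ∈ MulAction.orbit G y
  constructor
  · rintro ⟨h, hh⟩
    exact ⟨g * h, by simp only [mul_smul]; exact smul_eq_iff_eq_inv_smul g |>.2 hh⟩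
  · rintro ⟨h, rfl⟩
    exact ⟨g⁻¹ * h, mul_smul g⁻¹ h y⟩

/-- The space of expansions of the canonical structure of `G` in a language `L` that contains the
canonical language by means of `ι`: the `L`-structures whose reduct to the canonical language is
equal to the canonical structure. -/
def Expansions (ι : canonicalLanguage G →ᴸ L) : Type :=
  {M : Struc L // reduct ι M = canonicalStruc G}

variable {G} {ι : canonicalLanguage G →ᴸ L}

instance expansionsTopology : TopologicalSpace (Expansions G ι) :=
  inferInstanceAs (TopologicalSpace {M : Struc L // reduct ι M = canonicalStruc G})

instance expansionsMeasurableSpace : MeasurableSpace (Expansions G ι) :=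
  inferInstanceAs (MeasurableSpace {M : Struc L // reduct ι M = canonicalStruc G})

instance expansionsBorelSpace [∀ r, Countable (L.Relations r)] : BorelSpace (Expansions G ι) :=
  inferInstanceAs (BorelSpace {M : Struc L // reduct ι M = canonicalStruc G})

/-- The relativized logic action of `G` on the expansions of its canonical structure. -/
instance relativizedLogicAction : MulAction G (Expansions G ι) where
  smul g M := ⟨(g : Equiv.Perm ℕ) • M.1, by
    have h : reduct ι ((g : Equiv.Perm ℕ) • M.1) = (g : Equiv.Perm ℕ) • reduct ι M.1 := rfl
    rw [h, M.2, smul_canonicalStruc]⟩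
  one_smul M := Subtype.ext (one_smul _ M.1)
  mul_smul g h M := Subtype.ext (mul_smul (g : Equiv.Perm ℕ) (h : Equiv.Perm ℕ) M.1)

/-- An invariant random expansion: an invariant Borel probability measure on the expansions. -/
structure IsIRE (μ : Measure (Expansions G ι)) : Prop where
  isProbabilityMeasure : IsProbabilityMeasure μ
  invariant : SMulInvariantMeasure G (Expansions G ι) μ

/-- `μ` has no fixed point: for `μ`-almost every `M`, no point of `ℕ` is fixed by `Aut(M)`. -/
def HasNoFixedPoint (μ : Measure (Expansions G ι)) : Prop :=
  ∀ᵐ M ∂μ, MulAction.fixedPoints (aut M.1) ℕ = ∅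

/-- `μ` is concentrated on an orbit: some `G`-orbit is (`μ`-)measurable and has measure one. -/
def IsConcentratedOnOrbit (μ : Measure (Expansions G ι)) : Prop :=
  ∃ M : Expansions G ι,
    NullMeasurableSet (MulAction.orbit G M) μ ∧ μ (MulAction.orbit G M) = 1

end RandomExpansion

/-! Write `G_A` for `fixator G A`. The key claim is that, modulo null sets, the `G_A`-invariant
events form a countable partition into atoms, for every finite `A`. Almost surely, all orbits of
`aut M` are infinite (`ae_infinite_orbit_aut`): if `a` had a nontrivial finite orbit with positive
probability, invariance would spread that orbit evenly over an infinite `G_a`-orbit, supplied by the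
absence of algebraicity. Neumann's lemma then gives an automorphism `h` of `M` that moves `A` off
itself, and `h` lies in `G` because `M` expands the canonical structure. If `φ` is a `G_A`-invariant
map into Cantor space, then `φ M = φ (h⁻¹ • M)`. But `φ` and its translate by `h⁻¹` are invariant
under the stabilizers of the disjoint sets `A` and `hA`, so they are independent (by the de Finetti
property and ergodicity) and have the same law. Such variables almost never agree outside the atoms
of their law, so `φ M` is almost surely an atom (`ae_map_singleton_ne_zero`,
`exists_countable_atoms`). The atom of `M` over `A` now plays the role of an isolated type. On a
conull set it decides the relations on `A` and the atoms over one-point extensions of `A` that can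
be reached by `G_A`. A back-and-forth, as for countable atomic models, joins any two points of this
conull set by an element of `G`. -/

namespace RandomExpansion

/-! ### Analytic sets are universally measurable -/

/-- Choquet's capacity argument: bound the coordinates of Baire space one at a time, keeping the
measure of the image above `c`. The bounds cut out a compact box whose image is the required set. -/
theorem exists_isCompact_image_subset_lt_measure {X : Type*} [TopologicalSpace X] [T2Space X]
    [RegularSpace X] [MeasurableSpace X] [BorelSpace X] (μ : Measure X) [IsFiniteMeasure μ]
    {f : (ℕ → ℕ) → X} (hf : Continuous f) {c : ENNReal} (hc : c < μ (Set.range f)) :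
    ∃ K : Set X, IsCompact K ∧ K ⊆ Set.range f ∧ c ≤ μ K := by
  have step : ∀ (n : ℕ) (V : {V : Set (ℕ → ℕ) // c < μ (f '' V)}),
      ∃ m : ℕ, c < μ (f '' (V.1 ∩ {x | x n ≤ m})) := by
    rintro n ⟨V, hV⟩
    have hU : f '' V = ⋃ m : ℕ, f '' (V ∩ {x | x n ≤ m}) := by
      rw [← Set.image_iUnion, ← Set.inter_iUnion]
      congr 1
      refine (Set.inter_eq_left.2 fun x _ => Set.mem_iUnion.2 ⟨x n, le_refl (x n)⟩).symm
    have hmono : Monotone fun m : ℕ => f '' (V ∩ {x | x n ≤ m}) := fun m m' h =>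
      Set.image_mono (Set.inter_subset_inter_right _ fun x hx => le_trans hx h)
    -- Continuity from below holds for the outer measure, so the images need not be measurable.
    rw [hU, hmono.measure_iUnion] at hV
    exact lt_iSup_iff.1 hV
  choose k hk using step
  let V : ℕ → {V : Set (ℕ → ℕ) // c < μ (f '' V)} := fun n =>
    Nat.rec ⟨Set.univ, by rwa [Set.image_univ]⟩ (fun n V => ⟨_, hk n V⟩) n
  let b : ℕ → ℕ := fun n => k n (V n)
  have hV : ∀ n x, x ∈ (V n).1 ↔ ∀ i < n, x i ≤ b i := by
    intro n
    induction n with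
    | zero => intro x; simp [V]
    | succ n ih =>
      intro x
      change x ∈ (V n).1 ∩ {x | x n ≤ b n} ↔ _
      rw [Set.mem_inter_iff, ih]
      simp only [Set.mem_ofPred_eq, Nat.lt_succ_iff_lt_or_eq]
      constructor
      · rintro ⟨h, h'⟩ i (hi | rfl)
        exacts [h i hi, h']
      · exact fun h => ⟨fun i hi => h i (Or.inl hi), h n (Or.inr rfl)⟩
  let K : Set (ℕ → ℕ) := Set.univ.pi fun n => Set.Iic (b n)
  have hK : IsCompact K := isCompact_univ_pi fun n => (Set.finite_Iic _).isCompact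
  refine ⟨f '' K, hK.image hf, Set.image_subset_range _ _, ?_⟩
  have hanti : Antitone fun n => closure (f '' (V n).1) := by
    refine antitone_nat_of_succ_le fun n => closure_mono (Set.image_mono fun x hx => ?_)
    exact (hV n x).2 fun i hi => (hV (n + 1) x).1 hx i (by omega)
  have hsub : ⋂ n, closure (f '' (V n).1) ⊆ f '' K := by
    intro y hy
    by_contra hyK
    obtain ⟨O, O', hO, hO', hKO, hyO', hd⟩ :=
      SeparatedNhds.of_isCompact_isCompact (hK.image hf) (isCompact_singleton (x := y))
        (Set.disjoint_singleton_right.2 hyK)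
    have : ∃ n, (V n).1 ⊆ f ⁻¹' O := by
      by_contra! hcon
      simp only [Set.not_subset] at hcon
      choose x hxV hxO using hcon
      -- Truncation puts the sequence into the compact box. Each coordinate is changed only finitely
      -- often, so a limit of truncations is a limit of the original points.
      let z : ℕ → ℕ → ℕ := fun n i => min (x n i) (b i)
      obtain ⟨w, hwK, φ, hφ, hw⟩ := hK.tendsto_subseq (x := z)
        (fun n i _ => min_le_right (x n i) (b i))
      have hxw : Filter.Tendsto (fun n => x (φ n)) Filter.atTop (nhds w) := by
        rw [tendsto_pi_nhds] at hw ⊢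
        intro i
        refine (hw i).congr' ?_
        filter_upwards [Filter.eventually_gt_atTop i] with n hn
        exact min_eq_left ((hV _ _).1 (hxV (φ n)) i (hn.trans_le (hφ.id_le n)))
      have := hxw.eventually ((hO.preimage hf).mem_nhds (hKO ⟨w, hwK, rfl⟩))
      obtain ⟨n, hn⟩ := this.exists
      exact hxO _ hn
    obtain ⟨n, hn⟩ := this
    have hy' := Set.mem_iInter.1 hy n
    rw [mem_closure_iff] at hy'
    obtain ⟨_, h1, x, hx, rfl⟩ := hy' O' hO' (hyO' rfl)
    exact Set.disjoint_left.1 hd (hn hx) h1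
  refine le_trans ?_ (measure_mono hsub)
  rw [hanti.measure_iInter (fun n => isClosed_closure.measurableSet.nullMeasurableSet)
    ⟨0, measure_ne_top _ _⟩]
  exact le_iInf fun n => (V n).2.le.trans (measure_mono subset_closure)

/-- Countably many compact subsets exhaust the outer measure, so their union agrees almost
everywhere with the measurable hull, and the set lies between the two. -/
theorem nullMeasurableSet_of_analyticSet {X : Type*} [TopologicalSpace X] [T2Space X]
    [RegularSpace X] [MeasurableSpace X] [BorelSpace X] (μ : Measure X) [IsFiniteMeasure μ]
    {s : Set X} (hs : AnalyticSet s) : NullMeasurableSet s μ := by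
  rw [AnalyticSet] at hs
  obtain rfl | ⟨f, hf, rfl⟩ := hs
  · exact MeasurableSet.empty.nullMeasurableSet
  rcases eq_or_ne (μ (Set.range f)) 0 with h0 | h0
  · exact NullMeasurableSet.of_null h0
  obtain ⟨c, -, hc, hlim⟩ := exists_seq_strictMono_tendsto' (pos_iff_ne_zero.2 h0)
  choose K hK hKs hcK using fun n => exists_isCompact_image_subset_lt_measure μ hf (hc n).2
  have hT : MeasurableSet (⋃ n, K n) := .iUnion fun n => (hK n).measurableSet
  have hTs : ⋃ n, K n ⊆ Set.range f := Set.iUnion_subset hKs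
  have hμ : μ (Set.range f) ≤ μ (⋃ n, K n) :=
    le_of_tendsto' hlim fun n => (hcK n).trans (measure_mono (Set.subset_iUnion K n))
  have hae : (⋃ n, K n : Set X) =ᵐ[μ] toMeasurable μ (Set.range f) :=
    ae_eq_of_subset_of_measure_ge (hTs.trans (subset_toMeasurable _ _))
      (by rwa [measure_toMeasurable]) hT.nullMeasurableSet (measure_ne_top _ _)
  refine NullMeasurableSet.congr hT.nullMeasurableSet ?_
  exact (LE.le.eventuallyLE hTs).antisymm
    ((LE.le.eventuallyLE (subset_toMeasurable _ _)).trans hae.symm.le)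

/-! ### Neumann's lemma -/

/-- Otherwise the cosets `{g | g • a = b}` with `a, b ∈ A` cover the group. By Neumann's covering
lemma, one of the stabilizers involved has finite index, so it gives a finite orbit. -/
theorem exists_forall_smul_notMem {H α : Type*} [Group H] [MulAction H α]
    (h : ∀ a : α, (MulAction.orbit H a).Infinite) (A : Finset α) :
    ∃ g : H, ∀ a ∈ A, g • a ∉ A := by
  classical
  by_contra! hcon
  let s : Finset (α × α) := (A ×ˢ A).filter fun p => ∃ g : H, g • p.1 = p.2
  have hs : ∀ p : α × α, ∃ g : H, p ∈ s → g • p.1 = p.2 := by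
    intro p
    by_cases hp : p ∈ s
    · obtain ⟨g, hg⟩ := (Finset.mem_filter.1 hp).2
      exact ⟨g, fun _ => hg⟩
    · exact ⟨1, fun h => absurd h hp⟩
  choose c hc using hs
  have hcov : ⋃ p ∈ s, c p • (MulAction.stabilizer H p.1 : Set H) = Set.univ := by
    refine Set.eq_univ_of_forall fun g => ?_
    obtain ⟨a, ha, hga⟩ := hcon g
    have hp : (a, g • a) ∈ s := by simp [s, ha, hga]
    refine Set.mem_iUnion₂.2 ⟨_, hp, ?_⟩
    rw [mem_leftCoset_iff]
    change ((c (a, g • a))⁻¹ * g) • a = a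
    rw [mul_smul, inv_smul_eq_iff]
    exact (hc _ hp).symm
  obtain ⟨p, -, hp⟩ := Subgroup.exists_finiteIndex_of_leftCoset_cover hcov
  refine h p.1 ?_
  have := Subgroup.finite_quotient_of_finiteIndex (H := MulAction.stabilizer H p.1)
  exact Set.finite_coe_iff.1 (Finite.of_equiv _ (MulAction.orbitEquivQuotientStabilizer H p.1).symm)

/-! ### Measure-theoretic lemmas -/

/-- The joint law is `ν ⊗ ν`, and by Fubini the part of the diagonal over non-atoms of `ν` is null.
-/
theorem measure_eq_and_preimage_null {X Y : Type*} [MeasurableSpace X] [MeasurableSpace Y]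
    [MeasurableEq Y] {μ : Measure X} [IsProbabilityMeasure μ] {φ ψ : X → Y}
    (hφ : Measurable φ) (hψ : Measurable ψ) (hind : IndepFun φ ψ μ) (hlaw : μ.map φ = μ.map ψ) :
    μ {x | φ x = ψ x ∧ μ.map φ {φ x} = 0} = 0 := by
  have := Measure.isProbabilityMeasure_map (μ := μ) hφ.aemeasurable
  have hprod := (indepFun_iff_map_prod_eq_prod_map_map hφ.aemeasurable hψ.aemeasurable).1 hind
  rw [← hlaw] at hprod
  set ν := μ.map φ
  have hat : {y | ν {y} = 0}ᶜ.Countable := by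
    refine (Measure.countable_meas_pos_of_disjoint_iUnion (μ := ν) (As := fun y : Y => {y})
      (fun y => measurableSet_singleton y) fun y z h => Set.disjoint_singleton.2 h).mono ?_
    exact fun y hy => pos_iff_ne_zero.2 hy
  have hatm : MeasurableSet {y | ν {y} = 0} := hat.measurableSet.of_compl
  have hm : MeasurableSet {p : Y × Y | p.1 = p.2 ∧ ν {p.1} = 0} :=
    (measurableSet_eq_fun measurable_fst measurable_snd).inter (measurable_fst hatm)
  change μ ((fun x => (φ x, ψ x)) ⁻¹' {p : Y × Y | p.1 = p.2 ∧ ν {p.1} = 0}) = 0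
  rw [← Measure.map_apply (hφ.prodMk hψ) hm, hprod, Measure.measure_prod_null hm]
  refine Filter.Eventually.of_forall fun y => ?_
  by_cases hy : ν {y} = 0
  · refine measure_mono_null ?_ hy
    rintro z ⟨h, -⟩
    exact h.symm
  · refine measure_mono_null (t := ∅) ?_ measure_empty
    rintro z ⟨-, h⟩
    exact hy h

/-- A subset of a separable pseudometric space is separable: for each set of a countable dense
family and each radius `1 / (n + 1)`, choose a nearby member of `S` if there is one. -/
theorem exists_countable_dense_subfamily {X : Type*} [MeasurableSpace X] (μ : Measure X)
    [IsFiniteMeasure μ] [IsSeparable μ] (S : Set (Set X)) (hS : ∀ Y ∈ S, MeasurableSet Y) :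
    ∃ D ⊆ S, D.Countable ∧ ∀ Y ∈ S, ∀ ε : ENNReal, 0 < ε → ∃ Z ∈ D, μ (symmDiff Y Z) < ε := by
  obtain ⟨C, hC, hd⟩ := exists_countable_measureDense μ
  have hch : ∀ p : Set X × ℕ, ∃ Z, (∃ Y ∈ S, μ (symmDiff Y p.1) < ENNReal.ofReal (1 / (p.2 + 1))) →
      Z ∈ S ∧ μ (symmDiff Z p.1) < ENNReal.ofReal (1 / (p.2 + 1)) := by
    intro p
    by_cases h : ∃ Y ∈ S, μ (symmDiff Y p.1) < ENNReal.ofReal (1 / (p.2 + 1))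
    · exact ⟨h.choose, fun _ => h.choose_spec⟩
    · exact ⟨∅, fun h' => absurd h' h⟩
  choose F hF using hch
  let I : Set (Set X × ℕ) := {p | p.1 ∈ C ∧ ∃ Y ∈ S, μ (symmDiff Y p.1) <
    ENNReal.ofReal (1 / (p.2 + 1))}
  have hI : I.Countable := (hC.prod (Set.countable_univ (α := ℕ))).mono fun p hp =>
    Set.mem_prod.2 ⟨hp.1, Set.mem_univ p.2⟩
  refine ⟨F '' I, ?_, hI.image F, fun Y hY ε hε => ?_⟩
  · rintro _ ⟨p, hp, rfl⟩
    exact (hF p hp.2).1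
  obtain ⟨δ, hδ, hδε⟩ := ENNReal.lt_iff_exists_nnreal_btwn.1 hε
  have hδ0 : (0 : ℝ) < δ := by exact_mod_cast hδ
  obtain ⟨n, hn⟩ := exists_nat_one_div_lt (half_pos hδ0)
  obtain ⟨Z, hZ, hYZ⟩ := hd.approx Y (hS Y hY) (measure_ne_top _ _) (1 / ((n : ℝ) + 1))
    Nat.one_div_pos_of_nat
  have hp : (Z, n) ∈ I := ⟨hZ, Y, hY, hYZ⟩
  refine ⟨F (Z, n), ⟨_, hp, rfl⟩, lt_of_le_of_lt ?_ hδε⟩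
  have h2 := (hF (Z, n) hp.2).2
  rw [symmDiff_comm] at h2
  calc μ (symmDiff Y (F (Z, n))) ≤ μ (symmDiff Y Z) + μ (symmDiff Z (F (Z, n))) :=
        measure_symmDiff_le _ _ _
    _ ≤ ENNReal.ofReal (1 / (n + 1)) + ENNReal.ofReal (1 / (n + 1)) := add_le_add hYZ.le h2.le
    _ = ENNReal.ofReal (1 / (n + 1) + 1 / (n + 1)) :=
        (ENNReal.ofReal_add (by positivity) (by positivity)).symm
    _ ≤ ENNReal.ofReal δ := ENNReal.ofReal_le_ofReal (by linarith)
    _ = δ := ENNReal.ofReal_coe_nnreal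

/-! ### Back and forth -/

theorem exists_perm_of_back_and_forth {P : Set (Finset (ℕ × ℕ))} (hne : P.Nonempty)
    (hinj : ∀ p ∈ P, ∀ x ∈ p, ∀ y ∈ p, x.1 = y.1 ↔ x.2 = y.2)
    (forth : ∀ p ∈ P, ∀ m, ∃ q ∈ P, p ⊆ q ∧ ∃ n, (m, n) ∈ q)
    (back : ∀ p ∈ P, ∀ n, ∃ q ∈ P, p ⊆ q ∧ ∃ m, (m, n) ∈ q) :
    ∃ f : Equiv.Perm ℕ, ∀ s : Finset ℕ, ∃ p ∈ P, ∀ x ∈ s, (x, f x) ∈ p := by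
  have step : ∀ (n : ℕ) (p : P), ∃ q : P, p.1 ⊆ q.1 ∧ (∃ k, (n, k) ∈ q.1) ∧ ∃ k, (k, n) ∈ q.1 := by
    rintro n ⟨p, hp⟩
    obtain ⟨q, hq, hpq, k, hk⟩ := forth p hp n
    obtain ⟨r, hr, hqr, l, hl⟩ := back q hq n
    exact ⟨⟨r, hr⟩, hpq.trans hqr, ⟨k, hqr hk⟩, l, hl⟩
  choose F hF1 hF2 hF3 using step
  obtain ⟨p₀, hp₀⟩ := hne
  let p : ℕ → P := fun n => Nat.rec ⟨p₀, hp₀⟩ (fun n q => F n q) n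
  have hmono : Monotone fun n => (p n).1 := monotone_nat_of_le_succ fun n => hF1 n (p n)
  have hdom : ∀ n, ∃ k, (n, k) ∈ (p (n + 1)).1 := fun n => hF2 n (p n)
  have hran : ∀ n, ∃ k, (k, n) ∈ (p (n + 1)).1 := fun n => hF3 n (p n)
  choose f hf using hdom
  choose g hg using hran
  have key : ∀ {i j a b c d : ℕ}, (a, b) ∈ (p i).1 → (c, d) ∈ (p j).1 → (a = c ↔ b = d) :=
    fun {i j a b c d} hx hy => hinj _ (p (max i j)).2 (a, b) (hmono (le_max_left i j) hx) (c, d)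
      (hmono (le_max_right i j) hy)
  have hgf : ∀ n, g (f n) = n := fun n =>
    (key (i := f n + 1) (j := n + 1) (b := f n) (d := f n) (hg (f n)) (hf n)).2 rfl
  have hfg : ∀ n, f (g n) = n := fun n =>
    (key (i := g n + 1) (j := n + 1) (a := g n) (c := g n) (hf (g n)) (hg n)).1 rfl
  refine ⟨⟨f, g, hgf, hfg⟩, fun s => ⟨(p (s.sup id + 1)).1, (p (s.sup id + 1)).2, fun x hx => ?_⟩⟩
  exact hmono (Nat.succ_le_succ (Finset.le_sup (f := id) hx)) (hf x)

/-! ### The space of expansions -/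

variable {G : Subgroup (Equiv.Perm ℕ)} {L : FirstOrder.Language.{0, 0}}
  {ι : canonicalLanguage G →ᴸ L}

theorem expansions_smul_apply (g : G) (M : Expansions G ι) (r : ℕ) (R : L.Relations r)
    (x : Fin r → ℕ) : (g • M).1 r R x = M.1 r R (fun i => (g : Equiv.Perm ℕ)⁻¹ (x i)) := rfl

/-- Preserving the orbit of a tuple means agreeing on it with an element of `G`, so `f` lies in the
closure of `G`. -/
theorem mem_of_smul_canonicalStruc_eq (hG : IsClosed (G : Set (Equiv.Perm ℕ)))
    {f : Equiv.Perm ℕ} (hf : f • canonicalStruc G = canonicalStruc G) : f ∈ G := by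
  classical
  rw [← SetLike.mem_coe, ← hG.closure_eq,
    (Topology.IsInducing.mk rfl :
      Topology.IsInducing (fun g : Equiv.Perm ℕ => (g : ℕ → ℕ))).closure_eq_preimage_closure_image,
    Set.mem_preimage, mem_closure_iff]
  intro U hU hfU
  obtain ⟨I, u, hu, hIU⟩ := isOpen_pi_iff.1 hU _ hfU
  -- An initial segment containing `I`; its length is positive, as the canonical language requires.
  let x : Fin (I.sup id + 1) → ℕ := fun i => i
  let R : (canonicalLanguage G).Relations (I.sup id + 1) :=
    ⟨MulAction.orbit G x, Nat.succ_pos _, x, rfl⟩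
  have h1 : canonicalStruc G _ R (fun i => f (x i)) = true := by
    rw [← hf, smul_apply]
    simp [canonicalStruc, R]
  obtain ⟨g, hg⟩ : (fun i => f (x i)) ∈ MulAction.orbit G x := of_decide_eq_true h1
  refine ⟨_, hIU fun i hi => ?_, ⟨g, g.2, rfl⟩⟩
  have : (g : Equiv.Perm ℕ) i = f i :=
    congrFun hg ⟨i, Nat.lt_succ_of_le (Finset.le_sup (f := id) hi)⟩
  change (g : Equiv.Perm ℕ) i ∈ u i
  rw [this]
  exact (hu i hi).2

theorem mem_of_smul_eq (hG : IsClosed (G : Set (Equiv.Perm ℕ))) {M N : Expansions G ι}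
    {f : Equiv.Perm ℕ} (hf : f • M.1 = N.1) : f ∈ G := by
  refine mem_of_smul_canonicalStruc_eq hG ?_
  rw [← M.2]
  change reduct ι (f • M.1) = _
  rw [hf, N.2, M.2]

instance strucPolishSpace [∀ r, Countable (L.Relations r)] : PolishSpace (Struc L) :=
  have h : PolishSpace (∀ r : ℕ, L.Relations r → (Fin r → ℕ) → Bool) :=
    { toSecondCountableTopology := inferInstance
      toIsCompletelyMetrizableSpace := inferInstance }
  h

theorem isClosed_setOf_reduct_eq : IsClosed {M : Struc L | reduct ι M = canonicalStruc G} := by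
  have : {M : Struc L | reduct ι M = canonicalStruc G} =
      ⋂ (r : ℕ) (R : (canonicalLanguage G).Relations r) (x : Fin r → ℕ),
        {M : Struc L | M r (ι.onRelation R) x = canonicalStruc G r R x} := by
    ext M
    simp only [Set.mem_iInter]
    exact ⟨fun h r R x => congrFun (congrFun (congrFun h r) R) x,
      fun h => funext fun r => funext fun R => funext fun x => h r R x⟩
  rw [this]
  refine isClosed_iInter fun r => isClosed_iInter fun R => isClosed_iInter fun x => ?_
  refine isClosed_eq ?_ continuous_const
  have h1 : Continuous fun M : (∀ r : ℕ, L.Relations r → (Fin r → ℕ) → Bool) =>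
    M r (ι.onRelation R) x := by fun_prop
  exact h1

theorem measurable_expansions_apply (r : ℕ) (R : L.Relations r) (x : Fin r → ℕ) :
    Measurable fun M : Expansions G ι => M.1 r R x := by
  have h1 : Measurable fun M : (∀ r : ℕ, L.Relations r → (Fin r → ℕ) → Bool) => M r R x := by
    fun_prop
  have h2 : Measurable fun M : Expansions G ι => M.1 :=
    measurable_subtype_coe (p := fun M : Struc L => reduct ι M = canonicalStruc G)
  exact Measurable.comp (g := fun M : Struc L => M r R x) h1 h2

theorem measurable_expansions_apply_prod (r : ℕ) (R : L.Relations r) :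
    Measurable fun p : Expansions G ι × (Fin r → ℕ) => p.1.1 r R p.2 :=
  measurable_from_prod_countable_left fun x => measurable_expansions_apply r R x

theorem measurable_perm_apply (n : ℕ) : Measurable fun g : Equiv.Perm ℕ => g n := by
  have : Continuous fun g : Equiv.Perm ℕ => g n :=
    (continuous_apply n).comp (continuous_induced_dom (f := fun g : Equiv.Perm ℕ => (g : ℕ → ℕ)))
  exact this.measurable

theorem measurable_perm_inv_apply (n : ℕ) : Measurable fun g : Equiv.Perm ℕ => g⁻¹ n := by
  refine measurable_to_countable' fun m => ?_
  convert! (measurable_perm_apply m) (measurableSet_singleton n) using 1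
  ext g
  change g⁻¹ n = m ↔ g m = n
  rw [Equiv.Perm.inv_eq_iff_eq, eq_comm]

theorem measurable_expansions_smul :
    Measurable fun p : G × Expansions G ι => p.1 • p.2 := by
  refine Measurable.subtype_mk (f := fun p : G × Expansions G ι => (p.1 : Equiv.Perm ℕ) • p.2.1) ?_
  refine measurable_pi_iff.2 fun r => measurable_pi_iff.2 fun R => measurable_pi_iff.2 fun x => ?_
  refine (measurable_expansions_apply_prod r R).comp
    (f := fun p : G × Expansions G ι => (p.2, fun i => (p.1 : Equiv.Perm ℕ)⁻¹ (x i))) ?_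
  refine measurable_snd.prodMk (measurable_pi_iff.2 fun i => ?_)
  exact (measurable_perm_inv_apply (x i)).comp (measurable_subtype_coe.comp measurable_fst)

instance expansionsMeasurableConstSMul : MeasurableConstSMul G (Expansions G ι) :=
  ⟨fun _ => measurable_expansions_smul.comp (measurable_const.prodMk measurable_id)⟩

section

variable [∀ r, Countable (L.Relations r)]

instance expansionsPolishSpace : PolishSpace (Expansions G ι) :=
  (isClosed_setOf_reduct_eq (ι := ι)).polishSpace

/-- The expansions with an automorphism that maps `a` to `b`. -/
def autRel (ι : canonicalLanguage G →ᴸ L) (a b : ℕ) : Set (Expansions G ι) :=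
  {M | ∃ h : aut M.1, h • a = b}

/-- Quantifying over automorphisms is a projection of a Borel set. Coding a permutation together
with its inverse as two points of Baire space makes the ambient space Polish. -/
theorem analyticSet_autRel (a b : ℕ) : AnalyticSet (autRel ι a b) := by
  let s : Set ((ℕ → ℕ) × (ℕ → ℕ) × Expansions G ι) :=
    ({p | ∀ n, p.1 (p.2.1 n) = n} ∩ {p | ∀ n, p.2.1 (p.1 n) = n}) ∩
      ({p | p.1 a = b} ∩ {p | ∀ r (R : L.Relations r) (x : Fin r → ℕ),
        p.2.2.1 r R (fun i => p.2.1 (x i)) = p.2.2.1 r R x})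
  have heval : Measurable fun p : (ℕ → ℕ) × ℕ => p.1 p.2 :=
    measurable_from_prod_countable_left fun n => measurable_pi_apply n
  have hs : MeasurableSet s := by
    refine ((?_ : MeasurableSet _).inter ?_).inter ((?_ : MeasurableSet _).inter ?_)
    · rw [Set.ofPred_forall]
      refine MeasurableSet.iInter fun n => measurableSet_eq_fun (heval.comp
        (f := fun p : (ℕ → ℕ) × (ℕ → ℕ) × Expansions G ι => (p.1, p.2.1 n)) ?_) measurable_const
      fun_prop
    · rw [Set.ofPred_forall]
      refine MeasurableSet.iInter fun n => measurableSet_eq_fun (heval.comp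
        (f := fun p : (ℕ → ℕ) × (ℕ → ℕ) × Expansions G ι => (p.2.1, p.1 n)) ?_) measurable_const
      fun_prop
    · exact measurableSet_eq_fun (by fun_prop) measurable_const
    · simp only [Set.ofPred_forall]
      refine MeasurableSet.iInter fun r => .iInter fun R => .iInter fun x =>
        measurableSet_eq_fun ((measurable_expansions_apply_prod r R).comp
          (f := fun p : (ℕ → ℕ) × (ℕ → ℕ) × Expansions G ι =>
            (p.2.2, fun i => p.2.1 (x i))) ?_)
          ((measurable_expansions_apply r R x).comp (measurable_snd.comp measurable_snd))
      fun_prop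
  have himg : autRel ι a b = (fun p => p.2.2) '' s := by
    ext M
    constructor
    · rintro ⟨⟨h, hM⟩, hab⟩
      refine ⟨(h, ⇑h⁻¹, M), ⟨⟨fun n => by simp, fun n => by simp⟩, hab, fun r R x => ?_⟩, rfl⟩
      exact congrFun (congrFun (congrFun hM r) R) x
    · rintro ⟨⟨h, k, M⟩, ⟨⟨h1, h2⟩, hab, h3⟩, rfl⟩
      refine ⟨⟨⟨h, k, h2, h1⟩, ?_⟩, hab⟩
      exact funext fun r => funext fun R => funext fun x => h3 r R x
  rw [himg]
  exact hs.analyticSet_image (by fun_prop)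

theorem nullMeasurableSet_autRel (μ : Measure (Expansions G ι)) [IsFiniteMeasure μ] (a b : ℕ) :
    NullMeasurableSet (autRel ι a b) μ :=
  nullMeasurableSet_of_analyticSet μ (analyticSet_autRel a b)

end

theorem smul_mem_autRel {g : G} {M : Expansions G ι} {a b : ℕ} :
    g • M ∈ autRel ι (g • a) (g • b) ↔ M ∈ autRel ι a b := by
  have key : ∀ (g : G) (M : Expansions G ι) (a b : ℕ), M ∈ autRel ι a b →
      g • M ∈ autRel ι (g • a) (g • b) := by
    rintro g M a b ⟨⟨h, hM⟩, rfl⟩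
    refine ⟨⟨g * h * (g : Equiv.Perm ℕ)⁻¹, ?_⟩, ?_⟩
    · change ((g : Equiv.Perm ℕ) * h * (g : Equiv.Perm ℕ)⁻¹) • (g : Equiv.Perm ℕ) • M.1 =
        (g : Equiv.Perm ℕ) • M.1
      rw [MulAction.mem_stabilizer_iff] at hM
      rw [← mul_smul, inv_mul_cancel_right, mul_smul, hM]
    · change ((g : Equiv.Perm ℕ) * h * (g : Equiv.Perm ℕ)⁻¹) ((g : Equiv.Perm ℕ) a) =
        (g : Equiv.Perm ℕ) (h a)
      simp
  refine ⟨fun h => ?_, key g M a b⟩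
  simpa using key g⁻¹ _ _ _ h

/-! ### Orbits of the automorphism group -/

/-- The expansions for which the orbit of `a` under the automorphism group has at most `k`
elements. -/
def smallAutOrbit (ι : canonicalLanguage G →ᴸ L) (a k : ℕ) : Set (Expansions G ι) :=
  {M | ∀ B : Finset ℕ, B.card = k + 1 → ∃ b ∈ B, M ∉ autRel ι a b}

theorem smul_mem_smallAutOrbit {g : G} {M : Expansions G ι} {a k : ℕ} :
    g • M ∈ smallAutOrbit ι (g • a) k ↔ M ∈ smallAutOrbit ι a k := by
  have key : ∀ (g : G) (M : Expansions G ι) (a : ℕ), M ∈ smallAutOrbit ι a k →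
      g • M ∈ smallAutOrbit ι (g • a) k := by
    intro g M a hM B hB
    obtain ⟨b, hb, hMb⟩ := hM (B.image (g⁻¹ • ·))
      (by rw [Finset.card_image_of_injective _ (MulAction.injective _), hB])
    obtain ⟨c, hc, rfl⟩ := Finset.mem_image.1 hb
    refine ⟨c, hc, fun h => hMb ?_⟩
    rw [← smul_mem_autRel (g := g)]
    simpa using h
  refine ⟨fun h => ?_, key g M a⟩
  simpa using key g⁻¹ _ _ h

theorem nullMeasurableSet_smallAutOrbit [∀ r, Countable (L.Relations r)]
    (μ : Measure (Expansions G ι)) [IsFiniteMeasure μ] (a k : ℕ) :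
    NullMeasurableSet (smallAutOrbit ι a k) μ := by
  have : smallAutOrbit ι a k =
      ⋂ (B : Finset ℕ) (_ : B.card = k + 1), ⋃ b ∈ B, (autRel ι a b)ᶜ := by
    ext M
    simp [smallAutOrbit]
  rw [this]
  exact .iInter fun B => .iInter fun _ => .biUnion B.countable_toSet fun b _ =>
    (nullMeasurableSet_autRel μ a b).compl

/-- The sum is the expected number of points of `B` in the orbit of `a`, counted only when that
orbit has at most `k` elements. -/
theorem sum_measure_autRel_inter_le [∀ r, Countable (L.Relations r)]
    (μ : Measure (Expansions G ι)) [IsProbabilityMeasure μ] (a k : ℕ) (B : Finset ℕ) :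
    ∑ b ∈ B, μ (autRel ι a b ∩ smallAutOrbit ι a k) ≤ k := by
  classical
  have hE : ∀ b, NullMeasurableSet (autRel ι a b ∩ smallAutOrbit ι a k) μ := fun b =>
    (nullMeasurableSet_autRel μ a b).inter (nullMeasurableSet_smallAutOrbit μ a k)
  calc ∑ b ∈ B, μ (autRel ι a b ∩ smallAutOrbit ι a k)
      = ∑ b ∈ B, ∫⁻ M, (autRel ι a b ∩ smallAutOrbit ι a k).indicator 1 M ∂μ :=
        Finset.sum_congr rfl fun b _ => (lintegral_indicator_one₀ (hE b)).symm
    _ = ∫⁻ M, ∑ b ∈ B, (autRel ι a b ∩ smallAutOrbit ι a k).indicator 1 M ∂μ :=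
        (lintegral_finsetSum' _ fun b _ => aemeasurable_const.indicator₀ (hE b)).symm
    _ ≤ ∫⁻ _, (k : ENNReal) ∂μ := by
        refine lintegral_mono fun M => ?_
        simp only [Set.indicator_apply, Pi.one_apply, Finset.sum_boole]
        rw [Nat.cast_le]
        by_contra! hlt
        obtain ⟨C, hC, hcard⟩ := Finset.exists_subset_card_eq (Nat.succ_le_of_lt hlt)
        obtain ⟨b, hb⟩ : C.Nonempty := Finset.card_pos.1 (by omega)
        obtain ⟨c, hc, hMc⟩ := (Finset.mem_filter.1 (hC hb)).2.2 C hcard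
        exact hMc (Finset.mem_filter.1 (hC hc)).2.1
    _ = k := by simp

/-- The measure is the same for every point of the infinite `G_a`-orbit of `b`, while the sum over
any finite set of such points is at most `k`. -/
theorem measure_autRel_inter_smallAutOrbit [∀ r, Countable (L.Relations r)]
    (hG : NoAlgebraicity G) (μ : Measure (Expansions G ι)) [IsProbabilityMeasure μ]
    [SMulInvariantMeasure G (Expansions G ι) μ] {a b : ℕ} (hab : b ≠ a) (k : ℕ) :
    μ (autRel ι a b ∩ smallAutOrbit ι a k) = 0 := by
  by_contra h0
  have hinf : (MulAction.orbit (fixator G {a}) b).Infinite := by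
    intro hfin
    have : b ∈ acl G {a} := hfin
    rw [hG] at this
    exact hab (by simpa using this)
  obtain ⟨n, hn⟩ := ENNReal.exists_nat_mul_gt h0 (ENNReal.natCast_ne_top k)
  obtain ⟨B, hB, hcard⟩ := hinf.exists_subset_card_eq n
  have hconst : ∀ b' ∈ B, μ (autRel ι a b' ∩ smallAutOrbit ι a k) =
      μ (autRel ι a b ∩ smallAutOrbit ι a k) := by
    intro b' hb'
    obtain ⟨⟨g, hg⟩, rfl⟩ := hB hb'
    have hga : g • a = a := (mem_fixingSubgroup_iff G).1 hg a (by simp)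
    rw [← measure_preimage_smul μ g]
    congr 1
    ext M
    change g • M ∈ autRel ι a (g • b) ∧ g • M ∈ smallAutOrbit ι a k ↔ _
    nth_rw 1 [← hga]
    nth_rw 2 [← hga]
    rw [smul_mem_autRel, smul_mem_smallAutOrbit]
    rfl
  have := sum_measure_autRel_inter_le μ a k B
  rw [Finset.sum_congr rfl hconst, Finset.sum_const, hcard, nsmul_eq_mul] at this
  exact absurd hn (not_lt.2 this)

theorem ae_infinite_orbit_aut [∀ r, Countable (L.Relations r)]
    (hG : NoAlgebraicity G) (μ : Measure (Expansions G ι)) [IsProbabilityMeasure μ]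
    [SMulInvariantMeasure G (Expansions G ι) μ] (hfix : HasNoFixedPoint μ) :
    ∀ᵐ M ∂μ, ∀ a : ℕ, (MulAction.orbit (aut M.1) a).Infinite := by
  have h : ∀ᵐ M ∂μ, ∀ a b k : ℕ, b ≠ a → M ∉ autRel ι a b ∩ smallAutOrbit ι a k := by
    simp only [ae_all_iff]
    intro a b k hab
    exact measure_eq_zero_iff_ae_notMem.1 (measure_autRel_inter_smallAutOrbit hG μ hab k)
  filter_upwards [h, hfix] with M hM hMfix a hfin
  have hsmall : M ∈ smallAutOrbit ι a (MulAction.orbit (aut M.1) a).ncard := by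
    intro B hB
    by_contra! hcon
    have hsub : (B : Set ℕ) ⊆ MulAction.orbit (aut M.1) a := fun b hb => hcon b hb
    have := Set.ncard_le_ncard hsub hfin
    rw [Set.ncard_coe_finset] at this
    omega
  have : a ∈ MulAction.fixedPoints (aut M.1) ℕ := by
    intro g
    by_contra hne
    exact hM a _ _ hne ⟨⟨g, rfl⟩, hsmall⟩
  rw [hMfix] at this
  exact this

/-! ### Independence -/

theorem condExp_ae_eq_const {X : Type*} {m m₀ : MeasurableSpace X} (hm : m ≤ m₀)
    {μ : Measure X} [IsProbabilityMeasure μ]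
    (htriv : ∀ Y, MeasurableSet[m] Y → (∀ᵐ x ∂μ, x ∈ Y) ∨ ∀ᵐ x ∂μ, x ∉ Y) (f : X → ℝ) :
    μ[f|m] =ᵐ[μ] fun _ => ∫ x, f x ∂μ := by
  obtain ⟨c, hc⟩ : ∃ c : ℝ, μ[f|m] =ᵐ[μ] Function.const X c :=
    Filter.exists_eventuallyEq_const_of_forall_separating MeasurableSet fun U hU =>
      htriv _ (stronglyMeasurable_condExp.measurable hU)
  have h := integral_condExp hm (μ := μ) (f := f)
  rw [integral_congr_ae hc] at h
  simp only [Function.const_apply, integral_const, probReal_univ, one_smul] at h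
  rw [← h]
  exact hc

section

variable {H X : Type*} [Group H] [MeasurableSpace X] [MulAction H X] (μ : Measure X)

/-- Ergodicity settles the generators, and being null or conull passes to the generated σ-algebra.
-/
theorem ae_mem_or_ae_notMem_of_invariantSigma_top [ErgodicSMul H X μ] {K : Subgroup H}
    (hK : K = ⊤) {Y : Set X} (hY : MeasurableSet[invariantSigma K μ] Y) :
    (∀ᵐ x ∂μ, x ∈ Y) ∨ ∀ᵐ x ∂μ, x ∉ Y := by
  induction Y, hY using MeasurableSpace.generateFrom_induction with
  | hC Y hY _ =>
    rw [← Filter.eventuallyConst_set]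
    refine ErgodicSMul.aeconst_of_forall_preimage_smul_ae_eq (G := H) hY.1 fun g => ?_
    rw [Set.preimage_smul]
    exact (measure_symmDiff_eq_zero_iff.1 (hY.2 g⁻¹ (hK ▸ Subgroup.mem_top _))).symm
  | empty => exact Or.inr (by simp)
  | compl Y _ ih =>
    refine ih.symm.imp id fun h => ?_
    filter_upwards [h] with x hx using fun h => h hx
  | iUnion Y _ ih =>
    by_cases h : ∃ n, ∀ᵐ x ∂μ, x ∈ Y n
    · obtain ⟨n, hn⟩ := h
      refine Or.inl ?_
      filter_upwards [hn] with x hx using Set.mem_iUnion.2 ⟨n, hx⟩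
    · refine Or.inr ?_
      have : ∀ᵐ x ∂μ, ∀ n, x ∉ Y n :=
        ae_all_iff.2 fun n => (ih n).resolve_left fun h' => h ⟨n, h'⟩
      filter_upwards [this] with x hx
      simpa using hx

end

section

variable [∀ r, Countable (L.Relations r)]

/-- Over the empty set the stabilizer is all of `G`, so by ergodicity the conditioning σ-algebra is
trivial and conditional independence becomes independence. -/
theorem indep_invariantSigma (hG : IsDynamicallyDeFinetti G) (μ : Measure (Expansions G ι))
    [IsProbabilityMeasure μ] [ErgodicSMul G (Expansions G ι) μ] {A B : Finset ℕ}
    (hAB : A ∩ B = ∅) :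
    Indep (invariantSigma (fixator G A) μ) (invariantSigma (fixator G B) μ) μ := by
  have hci := hG.condIndep (Expansions G ι) measurable_expansions_smul μ A B
  rw [condIndep_iff _ _ _ _ (invariantSigma_le _ μ) (invariantSigma_le _ μ)] at hci
  have htop : fixator G (A ∩ B) = ⊤ := by
    rw [hAB]
    simp [fixator]
  have hconst := fun f => condExp_ae_eq_const (invariantSigma_le (fixator G (A ∩ B)) μ)
    (fun Y hY => ae_mem_or_ae_notMem_of_invariantSigma_top μ htop hY) f
  have hint : ∀ Y : Set (Expansions G ι), MeasurableSet Y →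
      ∫ x, Y.indicator (fun _ => (1 : ℝ)) x ∂μ = μ.real Y := fun Y hY => integral_indicator_one hY
  rw [Indep_iff]
  intro s t hs ht
  have hs' := invariantSigma_le _ μ _ hs
  have ht' := invariantSigma_le _ μ _ ht
  have h := hci s t hs ht
  obtain ⟨x, h1, h2, h3, h4⟩ := (h.and ((hconst _).and ((hconst _).and (hconst _)))).exists
  rw [Pi.mul_apply, h2, h3, h4, hint _ hs', hint _ ht', hint _ (hs'.inter ht')] at h1
  rw [← ENNReal.toReal_eq_toReal_iff' (measure_ne_top _ _) (by finiteness), ENNReal.toReal_mul]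
  exact h1

end

/-! ### Invariant sets -/

/-- The measurable sets of expansions that are invariant under the pointwise stabilizer of `A`. -/
def invariantSets (ι : canonicalLanguage G →ᴸ L) (A : Finset ℕ) : Set (Set (Expansions G ι)) :=
  {Y | MeasurableSet Y ∧ ∀ g ∈ fixator G A, ∀ M, g • M ∈ Y ↔ M ∈ Y}

theorem measurableSet_invariantSigma (μ : Measure (Expansions G ι)) {A : Finset ℕ}
    {Y : Set (Expansions G ι)} (hY : Y ∈ invariantSets ι A) :
    MeasurableSet[invariantSigma (fixator G A) μ] Y := by
  refine MeasurableSpace.measurableSet_generateFrom ⟨hY.1, fun g hg => ?_⟩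
  have : g • Y = Y := by
    ext M
    rw [Set.mem_smul_set_iff_inv_smul_mem, hY.2 _ (inv_mem hg)]
  rw [this, symmDiff_self]
  exact measure_empty

/-- A left coset of `G_A` is determined by the restriction of its elements to `A`, so there are only
countably many. This replaces quantifiers over the possibly uncountable `G` by countable ones. -/
theorem exists_countable_transversal (G : Subgroup (Equiv.Perm ℕ)) (A : Finset ℕ) :
    ∃ D : Set G, D.Countable ∧ ∀ g : G, ∃ d ∈ D, d⁻¹ * g ∈ fixator G A := by
  let e : G → (A → ℕ) := fun g a => g • (a : ℕ)
  refine ⟨Set.range fun f : Set.range e => f.2.choose, Set.countable_range _, fun g =>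
    ⟨_, ⟨⟨e g, g, rfl⟩, rfl⟩, ?_⟩⟩
  have h : e (⟨e g, g, rfl⟩ : Set.range e).2.choose = e g :=
    (⟨e g, g, rfl⟩ : Set.range e).2.choose_spec
  rw [mem_fixingSubgroup_iff]
  intro a ha
  rw [mul_smul, inv_smul_eq_iff]
  exact (congrFun h ⟨a, ha⟩).symm

theorem ae_forall_smul (μ : Measure (Expansions G ι))
    [SMulInvariantMeasure G (Expansions G ι) μ] [MeasurableConstSMul G (Expansions G ι)]
    {A : Finset ℕ} {P : Expansions G ι → Prop}
    (hP : ∀ g ∈ fixator G A, ∀ M, P (g • M) ↔ P M) (h : ∀ᵐ M ∂μ, P M) :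
    ∀ᵐ M ∂μ, ∀ g : G, P (g • M) := by
  obtain ⟨D, hD, hDG⟩ := exists_countable_transversal G A
  have h' : ∀ᵐ M ∂μ, ∀ d ∈ D, P (d⁻¹ • M) :=
    (ae_ball_iff hD).2 fun d _ => (measurePreserving_smul d⁻¹ μ).quasiMeasurePreserving.ae h
  filter_upwards [h'] with M hM g
  obtain ⟨d, hd, hdg⟩ := hDG g⁻¹
  have := (hP _ (inv_mem hdg) (d⁻¹ • M)).2 (hM d hd)
  simpa [mul_smul] using this

theorem saturation_mem_invariantSets [MeasurableConstSMul G (Expansions G ι)] {A B : Finset ℕ}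
    (hAB : A ⊆ B) {Y : Set (Expansions G ι)} (hY : Y ∈ invariantSets ι B) :
    {M | ∃ g ∈ fixator G A, g • M ∈ Y} ∈ invariantSets ι A := by
  constructor
  · obtain ⟨D, hD, hDG⟩ := exists_countable_transversal G B
    have : {M | ∃ g ∈ fixator G A, g • M ∈ Y} =
        ⋃ d ∈ D ∩ fixator G A, (fun M => d⁻¹ • M) ⁻¹' Y := by
      ext M
      simp only [Set.mem_iUnion, Set.mem_preimage, exists_prop]
      constructor
      · rintro ⟨g, hg, hM⟩
        obtain ⟨d, hd, hdg⟩ := hDG g⁻¹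
        have hdA : d ∈ fixator G A := by
          have := mul_mem (inv_mem hg)
            (inv_mem (fixingSubgroup_antitone G ℕ (Finset.coe_subset.2 hAB) hdg))
          simpa using this
        refine ⟨d, ⟨hd, hdA⟩, ?_⟩
        rw [← hY.2 _ hdg] at hM
        simpa [mul_smul] using hM
      · rintro ⟨d, ⟨-, hd⟩, hM⟩
        exact ⟨d⁻¹, inv_mem hd, hM⟩
    rw [this]
    exact .biUnion (hD.mono Set.inter_subset_left) fun d _ => measurable_const_smul d⁻¹ hY.1
  · intro g hg M
    constructor
    · rintro ⟨h, hh, hM⟩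
      exact ⟨h * g, mul_mem hh hg, by rwa [mul_smul]⟩
    · rintro ⟨h, hh, hM⟩
      exact ⟨h * g⁻¹, mul_mem hh (inv_mem hg), by simpa [mul_smul] using hM⟩

section

variable [∀ r, Countable (L.Relations r)]

theorem ae_map_singleton_ne_zero (hG : IsDynamicallyDeFinetti G) (μ : Measure (Expansions G ι))
    [IsProbabilityMeasure μ] [ErgodicSMul G (Expansions G ι) μ] (hfix : HasNoFixedPoint μ)
    {A : Finset ℕ} {φ : Expansions G ι → ℕ → Bool} (hφ : Measurable φ)
    (hinv : ∀ g ∈ fixator G A, ∀ M, φ (g • M) = φ M) :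
    ∀ᵐ M ∂μ, μ.map φ {φ M} ≠ 0 := by
  have hnull : ∀ g : G, (∀ a ∈ A, g • a ∉ A) →
      ∀ᵐ M ∂μ, ¬(φ M = φ (g⁻¹ • M) ∧ μ.map φ {φ M} = 0) := by
    intro g hg
    let B : Finset ℕ := A.image (g • ·)
    have hAB : A ∩ B = ∅ := by
      rw [← Finset.disjoint_iff_inter_eq_empty, Finset.disjoint_right]
      intro b hb
      obtain ⟨a, ha, rfl⟩ := Finset.mem_image.1 hb
      exact hg a ha
    have hψ : Measurable fun M => φ (g⁻¹ • M) := hφ.comp (measurable_const_smul g⁻¹)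
    refine measure_eq_zero_iff_ae_notMem.1 (measure_eq_and_preimage_null hφ hψ ?_ ?_)
    · rw [IndepFun_iff_Indep]
      refine indep_of_indep_of_le_left (indep_of_indep_of_le_right
        (indep_invariantSigma hG μ hAB) ?_) ?_
      · rintro _ ⟨U, hU, rfl⟩
        refine measurableSet_invariantSigma μ ⟨hψ hU, fun h hh M => ?_⟩
        have hconj : g⁻¹ * h * g ∈ fixator G A := by
          rw [mem_fixingSubgroup_iff] at hh ⊢
          intro a ha
          rw [mul_smul, mul_smul, inv_smul_eq_iff]
          exact hh _ (Finset.mem_coe.2 (Finset.mem_image_of_mem _ ha))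
        have := hinv _ hconj (g⁻¹ • M)
        simp only [mul_smul, smul_inv_smul] at this
        simp only [Set.mem_preimage, this]
      · rintro _ ⟨U, hU, rfl⟩
        refine measurableSet_invariantSigma μ ⟨hφ hU, fun h hh M => ?_⟩
        simp only [Set.mem_preimage, hinv h hh M]
    · have : μ.map (φ ∘ (g⁻¹ • ·)) = μ.map φ := by
        rw [← Measure.map_map hφ (measurable_const_smul g⁻¹), (measurePreserving_smul g⁻¹ μ).map_eq]
      exact this.symm
  obtain ⟨D, hD, hDG⟩ := exists_countable_transversal G A
  have hD' : ∀ᵐ M ∂μ, ∀ g ∈ D, (∀ a ∈ A, g • a ∉ A) →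
      ¬(φ M = φ (g⁻¹ • M) ∧ μ.map φ {φ M} = 0) := by
    refine (ae_ball_iff hD).2 fun g _ => ?_
    by_cases hg : ∀ a ∈ A, g • a ∉ A
    · filter_upwards [hnull g hg] with M hM _ using hM
    · exact .of_forall fun M h => absurd h hg
  filter_upwards [hD', ae_infinite_orbit_aut hG.noAlgebraicity μ hfix] with M hM hinf h0
  -- The automorphism `h` depends on `M`. It is replaced by a representative `g` of its coset modulo
  -- `G_A`, so that only countably many null sets are discarded.
  obtain ⟨h, hA⟩ := exists_forall_smul_notMem hinf A
  have hhM : (h : Equiv.Perm ℕ) • M.1 = M.1 := h.2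
  let h' : G := ⟨h, mem_of_smul_eq hG.isClosed hhM⟩
  have hh'M : h' • M = M := Subtype.ext hhM
  obtain ⟨g, hgD, hgh⟩ := hDG h'
  have hgA : ∀ a ∈ A, g • a = h • a := by
    intro a ha
    have := (mem_fixingSubgroup_iff G).1 hgh a ha
    rw [mul_smul, inv_smul_eq_iff] at this
    exact this.symm
  refine hM g hgD (fun a ha => by rw [hgA a ha]; exact hA a ha) ⟨?_, h0⟩
  rw [← hinv _ hgh M, mul_smul, hh'M]

/-- Let `φ` record membership in a countable dense family of invariant sets; the atoms are its
fibres of positive measure. A set `Y` splitting a fibre into two non-null pieces would be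
approximated by some `d n` more closely than either piece allows, yet `d n` contains or misses the
whole fibre. -/
theorem exists_countable_atoms (hG : IsDynamicallyDeFinetti G) (μ : Measure (Expansions G ι))
    [IsProbabilityMeasure μ] [ErgodicSMul G (Expansions G ι) μ] (hfix : HasNoFixedPoint μ)
    (A : Finset ℕ) :
    ∃ T ⊆ invariantSets ι A, T.Countable ∧ (∀ᵐ M ∂μ, ∃ t ∈ T, M ∈ t) ∧
      ∀ t ∈ T, ∀ Y ∈ invariantSets ι A, μ (t ∩ Y) = 0 ∨ μ (t \ Y) = 0 := by
  classical
  obtain ⟨D, hDS, hD, hdense⟩ := exists_countable_dense_subfamily μ (invariantSets ι A)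
    fun Y hY => hY.1
  have hne : D.Nonempty := by
    obtain ⟨Z, hZ, -⟩ := hdense Set.univ ⟨MeasurableSet.univ, by simp⟩ 1 one_pos
    exact ⟨Z, hZ⟩
  obtain ⟨d, rfl⟩ := hD.exists_eq_range hne
  have hdS : ∀ n, d n ∈ invariantSets ι A := fun n => hDS ⟨n, rfl⟩
  let φ : Expansions G ι → ℕ → Bool := fun M n => decide (M ∈ d n)
  have hφ : Measurable φ := by
    refine measurable_pi_iff.2 fun n => measurable_to_bool ?_
    convert! (hdS n).1 using 1
    ext M
    simp [φ]
  have hinv : ∀ g ∈ fixator G A, ∀ M, φ (g • M) = φ M := by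
    intro g hg M
    funext n
    simp only [φ, (hdS n).2 g hg M]
  have hcount : {y | μ.map φ {y} ≠ 0}.Countable := by
    refine (Measure.countable_meas_pos_of_disjoint_iUnion (μ := μ.map φ) (As := fun y => {y})
      (fun y => measurableSet_singleton y) fun y z h => Set.disjoint_singleton.2 h).mono ?_
    exact fun y hy => pos_iff_ne_zero.2 hy
  refine ⟨(fun y => φ ⁻¹' {y}) '' {y | μ.map φ {y} ≠ 0}, ?_, hcount.image _, ?_, ?_⟩
  · rintro _ ⟨y, -, rfl⟩
    refine ⟨hφ (measurableSet_singleton y), fun g hg M => ?_⟩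
    simp only [Set.mem_preimage, hinv g hg M]
  · filter_upwards [ae_map_singleton_ne_zero hG μ hfix hφ hinv] with M hM
    exact ⟨_, ⟨φ M, hM, rfl⟩, rfl⟩
  · rintro _ ⟨y, -, rfl⟩ Y hY
    by_contra! hcon
    obtain ⟨_, ⟨n, rfl⟩, hn⟩ := hdense Y hY
      (min (μ (φ ⁻¹' {y} ∩ Y)) (μ (φ ⁻¹' {y} \ Y)))
      (lt_min (pos_iff_ne_zero.2 hcon.1) (pos_iff_ne_zero.2 hcon.2))
    have hmem : ∀ M, φ M = y → (M ∈ d n ↔ y n = true) := by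
      rintro M rfl
      simp [φ]
    refine hn.not_ge ?_
    by_cases hy : y n = true
    · refine (min_le_right _ _).trans (measure_mono ?_)
      rintro M ⟨hM, hMY⟩
      exact Or.inr ⟨(hmem M hM).2 hy, hMY⟩
    · refine (min_le_left _ _).trans (measure_mono ?_)
      rintro M ⟨hM, hMY⟩
      exact Or.inl ⟨hMY, fun h => hy ((hmem M hM).1 h)⟩

end

/-! ### The orbit -/

/-- Discarding the null sets among `t`, `t ∩ Y` and `t \ Y`, for all translates, turns "decided up
to a null set" into "decided" at every remaining point. -/
theorem ae_forall_atoms (μ : Measure (Expansions G ι))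
    [SMulInvariantMeasure G (Expansions G ι) μ] [MeasurableConstSMul G (Expansions G ι)]
    {T 𝒴 : Finset ℕ → Set (Set (Expansions G ι))}
    (hTS : ∀ A, T A ⊆ invariantSets ι A) (hT : ∀ A, (T A).Countable)
    (hcov : ∀ A, ∀ᵐ M ∂μ, ∃ t ∈ T A, M ∈ t)
    (hatom : ∀ A, ∀ t ∈ T A, ∀ Y ∈ invariantSets ι A, μ (t ∩ Y) = 0 ∨ μ (t \ Y) = 0)
    (h𝒴S : ∀ A, 𝒴 A ⊆ invariantSets ι A) (h𝒴 : ∀ A, (𝒴 A).Countable) :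
    ∃ X₀ : Set (Expansions G ι), (∀ᵐ M ∂μ, M ∈ X₀) ∧
      (∀ M ∈ X₀, ∀ (A : Finset ℕ) (g : G), ∃ t ∈ T A, g • M ∈ t) ∧
      (∀ M ∈ X₀, ∀ (A : Finset ℕ) (g : G), ∀ t ∈ T A, g • M ∈ t → μ t ≠ 0) ∧
      ∀ M ∈ X₀, ∀ N ∈ X₀, ∀ (A : Finset ℕ) (g h : G), ∀ t ∈ T A, g • M ∈ t → h • N ∈ t →
        ∀ Y ∈ 𝒴 A, g • M ∈ Y → h • N ∈ Y := by
  let P : Finset ℕ → Expansions G ι → Prop := fun A M => (∃ t ∈ T A, M ∈ t) ∧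
    ∀ t ∈ T A, (M ∈ t → μ t ≠ 0) ∧ ∀ Y ∈ 𝒴 A, (M ∈ t ∩ Y → μ (t ∩ Y) ≠ 0) ∧ (M ∈ t \ Y → μ (t \ Y) ≠ 0)
  have hP : ∀ A, ∀ᵐ M ∂μ, P A M := by
    intro A
    have key : ∀ s : Set (Expansions G ι), ∀ᵐ M ∂μ, M ∈ s → μ s ≠ 0 := by
      intro s
      by_cases hs : μ s = 0
      · filter_upwards [measure_eq_zero_iff_ae_notMem.1 hs] with M hM h using absurd h hM
      · exact .of_forall fun _ _ => hs
    exact (hcov A).and ((ae_ball_iff (hT A)).2 fun t _ => (key t).and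
      ((ae_ball_iff (h𝒴 A)).2 fun Y _ => (key _).and (key _)))
  have hPinv : ∀ A, ∀ g ∈ fixator G A, ∀ M, P A (g • M) ↔ P A M := by
    intro A g hg M
    refine and_congr ?_ ?_
    · exact exists_congr fun t => and_congr_right fun ht => (hTS A ht).2 g hg M
    · refine forall₂_congr fun t ht => and_congr (by rw [(hTS A ht).2 g hg M])
        (forall₂_congr fun Y hY => ?_)
      simp only [Set.mem_inter_iff, Set.mem_sdiff, (hTS A ht).2 g hg M, (h𝒴S A hY).2 g hg M]
  refine ⟨{M | ∀ A (g : G), P A (g • M)},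
    ae_all_iff.2 fun A => ae_forall_smul μ (hPinv A) (hP A), fun M hM A g => (hM A g).1,
    fun M hM A g t ht => ((hM A g).2 t ht).1, ?_⟩
  intro M hM N hN A g h t ht hMt hNt Y hY hMY
  by_contra hNY
  have h1 := (((hM A g).2 t ht).2 Y hY).1 ⟨hMt, hMY⟩
  have h2 := (((hN A h).2 t ht).2 Y hY).2 ⟨hNt, hNY⟩
  exact (hatom A t ht Y (h𝒴S A hY)).elim h1 h2

theorem setOf_apply_mem_invariantSets {A : Finset ℕ} {r : ℕ} (R : L.Relations r)
    {x : Fin r → ℕ} (hx : ∀ i, x i ∈ A) :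
    {M : Expansions G ι | M.1 r R x = true} ∈ invariantSets ι A := by
  refine ⟨measurable_expansions_apply r R x (measurableSet_singleton true), fun g hg M => ?_⟩
  have : (fun i => (g : Equiv.Perm ℕ)⁻¹ (x i)) = x := by
    funext i
    exact (mem_fixingSubgroup_iff G).1 (inv_mem hg) (x i) (hx i)
  simp only [Set.mem_ofPred_eq, expansions_smul_apply, this]

/-- The sets along which atoms are compared in the back-and-forth argument. -/
def testSets (T : Finset ℕ → Set (Set (Expansions G ι))) (A : Finset ℕ) :
    Set (Set (Expansions G ι)) :=
  T A ∪ (⋃ (r : ℕ) (R : L.Relations r) (x : Fin r → ℕ) (_ : ∀ i, x i ∈ A),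
      {{M : Expansions G ι | M.1 r R x = true}}) ∪
    ⋃ c : ℕ, (fun s => {M | ∃ g ∈ fixator G A, g • M ∈ s}) '' T (insert c A)

section

variable [∀ r, Countable (L.Relations r)]

theorem exists_conull_back_and_forth (hG : IsDynamicallyDeFinetti G)
    (μ : Measure (Expansions G ι)) [IsProbabilityMeasure μ] [ErgodicSMul G (Expansions G ι) μ]
    (hfix : HasNoFixedPoint μ) :
    ∃ (X₀ : Set (Expansions G ι)) (T : Finset ℕ → Set (Set (Expansions G ι))),
      (∀ᵐ M ∂μ, M ∈ X₀) ∧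
      (∀ M ∈ X₀, ∀ N ∈ X₀, ∃ t ∈ T ∅, M ∈ t ∧ N ∈ t) ∧
      (∀ M ∈ X₀, ∀ N ∈ X₀, ∀ (A : Finset ℕ) (g h : G), ∀ t ∈ T A, g • M ∈ t → h • N ∈ t →
        ∀ c, ∃ k ∈ fixator G A, ∃ s ∈ T (insert c A), g • M ∈ s ∧ (k * h) • N ∈ s) ∧
      ∀ M ∈ X₀, ∀ N ∈ X₀, ∀ (A : Finset ℕ) (g h : G), ∀ t ∈ T A, g • M ∈ t → h • N ∈ t →
        ∀ (r : ℕ) (R : L.Relations r) (x : Fin r → ℕ), (∀ i, x i ∈ A) →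
          (g • M).1 r R x = (h • N).1 r R x := by
  choose T hTS hT hcov hatom using exists_countable_atoms hG μ hfix
  have hS : ∀ A, testSets T A ⊆ invariantSets ι A := by
    intro A Y hY
    obtain (hY | hY) | hY := hY
    · exact hTS A hY
    · simp only [Set.mem_iUnion, Set.mem_singleton_iff] at hY
      obtain ⟨r, R, x, hx, rfl⟩ := hY
      exact setOf_apply_mem_invariantSets R hx
    · obtain ⟨c, s, hs, rfl⟩ := Set.mem_iUnion.1 hY
      exact saturation_mem_invariantSets (Finset.subset_insert c A) (hTS _ hs)
  have hC : ∀ A, (testSets T A).Countable := by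
    intro A
    refine ((hT A).union ?_).union ?_
    · exact Set.countable_iUnion fun r => Set.countable_iUnion fun R => Set.countable_iUnion
        fun x => Set.countable_iUnion fun _ => Set.countable_singleton _
    · exact Set.countable_iUnion fun c => (hT _).image _
  obtain ⟨X₀, hX₀, hmem, hpos, htest⟩ := ae_forall_atoms μ hTS hT hcov hatom hS hC
  refine ⟨X₀, T, hX₀, ?_, ?_, ?_⟩
  · intro M hM N hN
    obtain ⟨t, ht, hMt⟩ := hmem M hM ∅ 1
    obtain ⟨s, hs, hNs⟩ := hmem N hN ∅ 1
    -- Atoms over the empty set are `G`-invariant, hence conull by ergodicity. A common point `K` of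
    -- `t` and `s` then transfers membership in `t` to `N`.
    have hconull : ∀ u ∈ T ∅, μ u ≠ 0 → ∀ᵐ K ∂μ, K ∈ u := by
      intro u hu h0
      have hconst : Filter.EventuallyConst u (ae μ) := by
        refine ErgodicSMul.aeconst_of_forall_preimage_smul_ae_eq (G := G) (hTS ∅ hu).1 fun g => ?_
        refine Filter.EventuallyEq.of_eq (Set.ext fun K => (hTS ∅ hu).2 g ?_ K)
        simp [fixator]
      exact (Filter.eventuallyConst_set.1 hconst).resolve_right
        fun h => h0 (measure_eq_zero_iff_ae_notMem.2 h)
    obtain ⟨K, hK, hKt, hKs⟩ := (hX₀.and ((hconull t ht (hpos M hM ∅ 1 t ht hMt)).and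
      (hconull s hs (hpos N hN ∅ 1 s hs hNs)))).exists
    have hNt := htest K hK N hN ∅ 1 1 s hs (by rwa [one_smul]) hNs t (Or.inl (Or.inl ht))
      (by rwa [one_smul])
    rw [one_smul] at hMt hNt
    exact ⟨t, ht, hMt, hNt⟩
  · intro M hM N hN A g h t ht hMt hNt c
    obtain ⟨s, hs, hMs⟩ := hmem M hM (insert c A) g
    -- The `G_A`-saturation of `s` is a test set over `A`, so the shared atom `t` forces `h • N` to
    -- reach `s` by some `k` fixing `A`.
    obtain ⟨k, hk, hNk⟩ := htest M hM N hN A g h t ht hMt hNt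
      {M | ∃ g ∈ fixator G A, g • M ∈ s} (Or.inr (Set.mem_iUnion.2 ⟨c, s, hs, rfl⟩))
      ⟨1, one_mem _, by rwa [one_smul]⟩
    exact ⟨k, hk, s, hs, hMs, by rwa [mul_smul]⟩
  · intro M hM N hN A g h t ht hMt hNt r R x hx
    have hY : {M : Expansions G ι | M.1 r R x = true} ∈ testSets T A :=
      Or.inl (Or.inr (by simp only [Set.mem_iUnion]; exact ⟨r, R, x, hx, rfl⟩))
    exact Bool.eq_iff_iff.2 ⟨htest M hM N hN A g h t ht hMt hNt _ hY,
      htest N hN M hM A h g t ht hNt hMt _ hY⟩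

theorem exists_conull_forall_exists_smul_eq (hG : IsDynamicallyDeFinetti G)
    (μ : Measure (Expansions G ι)) [IsProbabilityMeasure μ] [ErgodicSMul G (Expansions G ι) μ]
    (hfix : HasNoFixedPoint μ) :
    ∃ X₀ : Set (Expansions G ι), (∀ᵐ M ∂μ, M ∈ X₀) ∧
      ∀ M ∈ X₀, ∀ N ∈ X₀, ∃ f : G, f • M = N := by
  obtain ⟨X₀, T, hX₀, hbase, hext, hrel⟩ := exists_conull_back_and_forth hG μ hfix
  refine ⟨X₀, hX₀, fun M hM N hN => ?_⟩
  -- The finite partial map is `h⁻¹ g` on `g⁻¹ A`: both structures are moved so that the matched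
  -- points coincide in `A`, where their atoms can be compared. Multiplying `g` or `h` on the left
  -- by an element of `G_A` does not change it.
  let graph : Finset ℕ → G → G → Finset (ℕ × ℕ) := fun A g h =>
    A.image fun a => (g⁻¹ • a, h⁻¹ • a)
  let P : Set (Finset (ℕ × ℕ)) :=
    {p | ∃ (A : Finset ℕ) (g h : G), ∃ t ∈ T A, g • M ∈ t ∧ h • N ∈ t ∧ graph A g h = p}
  have hgraph : ∀ (A : Finset ℕ) (c : ℕ) (g h : G), ∀ k ∈ fixator G A,
      graph A g h ⊆ graph (insert c A) g (k * h) ∧ graph A g h ⊆ graph (insert c A) (k * g) h := by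
    intro A c g h k hk
    have hka : ∀ a ∈ A, k⁻¹ • a = a := (mem_fixingSubgroup_iff G).1 (inv_mem hk)
    constructor
    all_goals
      intro p hp
      obtain ⟨a, ha, rfl⟩ := Finset.mem_image.1 hp
      refine Finset.mem_image.2 ⟨a, Finset.mem_insert_of_mem ha, ?_⟩
      simp only [mul_inv_rev, mul_smul, hka a ha]
  have hne : P.Nonempty := by
    obtain ⟨t, ht, hMt, hNt⟩ := hbase M hM N hN
    exact ⟨_, ∅, 1, 1, t, ht, by rwa [one_smul], by rwa [one_smul], rfl⟩
  have hinj : ∀ p ∈ P, ∀ x ∈ p, ∀ y ∈ p, x.1 = y.1 ↔ x.2 = y.2 := by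
    rintro _ ⟨A, g, h, t, ht, hMt, hNt, rfl⟩ x hx y hy
    obtain ⟨a, ha, rfl⟩ := Finset.mem_image.1 hx
    obtain ⟨b, hb, rfl⟩ := Finset.mem_image.1 hy
    simp
  have forth : ∀ p ∈ P, ∀ m, ∃ q ∈ P, p ⊆ q ∧ ∃ n, (m, n) ∈ q := by
    rintro _ ⟨A, g, h, t, ht, hMt, hNt, rfl⟩ m
    -- After moving by `g`, the new point `m` of `M` sits at `g • m`, so this is the point added to
    -- `A`.
    obtain ⟨k, hk, s, hs, hMs, hNs⟩ := hext M hM N hN A g h t ht hMt hNt (g • m)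
    refine ⟨_, ⟨_, g, k * h, s, hs, hMs, hNs, rfl⟩, (hgraph A _ g h k hk).1,
      (k * h)⁻¹ • g • m, Finset.mem_image.2 ⟨g • m, Finset.mem_insert_self _ _, ?_⟩⟩
    rw [inv_smul_smul]
  have back : ∀ p ∈ P, ∀ n, ∃ q ∈ P, p ⊆ q ∧ ∃ m, (m, n) ∈ q := by
    rintro _ ⟨A, g, h, t, ht, hMt, hNt, rfl⟩ n
    obtain ⟨k, hk, s, hs, hNs, hMs⟩ := hext N hN M hM A h g t ht hNt hMt (h • n)
    refine ⟨_, ⟨_, k * g, h, s, hs, hMs, hNs, rfl⟩, (hgraph A _ g h k hk).2,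
      (k * g)⁻¹ • h • n, Finset.mem_image.2 ⟨h • n, Finset.mem_insert_self _ _, ?_⟩⟩
    rw [inv_smul_smul]
  obtain ⟨f, hf⟩ := exists_perm_of_back_and_forth hne hinj forth back
  have hfM : f • M.1 = N.1 := by
    funext r R x
    obtain ⟨_, ⟨A, g, h, t, ht, hMt, hNt, rfl⟩, hs⟩ :=
      hf (Finset.univ.image fun i => f⁻¹ (x i))
    have hx : ∀ i, ∃ a ∈ A, g⁻¹ • a = f⁻¹ (x i) ∧ h⁻¹ • a = x i := by
      intro i
      obtain ⟨a, ha, hax⟩ := Finset.mem_image.1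
        (hs (f⁻¹ (x i)) (Finset.mem_image_of_mem _ (Finset.mem_univ i)))
      rw [show f (f⁻¹ (x i)) = x i from f.apply_symm_apply (x i), Prod.mk.injEq] at hax
      exact ⟨a, ha, hax⟩
    choose a haA haf hax using hx
    have := hrel M hM N hN A g h t ht hMt hNt r R a haA
    rw [expansions_smul_apply, expansions_smul_apply] at this
    rw [smul_apply, ← funext haf, ← funext hax]
    exact this
  exact ⟨⟨f, mem_of_smul_eq hG.isClosed hfM⟩, Subtype.ext hfM⟩

end

end RandomExpansion


theorem mainTheorem5
    (G : Subgroup (Equiv.Perm ℕ)) (hG : RandomExpansion.IsDynamicallyDeFinetti G)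
    (L : FirstOrder.Language.{0, 0}) [L.IsRelational] [∀ r, Countable (L.Relations r)]
    (ι : RandomExpansion.canonicalLanguage G →ᴸ L) (hι : ι.Injective)
    (μ : MeasureTheory.Measure (RandomExpansion.Expansions G ι))
    (hμ : RandomExpansion.IsIRE μ) (hergodic : ErgodicSMul G (RandomExpansion.Expansions G ι) μ)
    (hfix : RandomExpansion.HasNoFixedPoint μ) :
    RandomExpansion.IsConcentratedOnOrbit μ := by
  have := hμ.isProbabilityMeasure
  obtain ⟨X₀, hX₀, hX⟩ := RandomExpansion.exists_conull_forall_exists_smul_eq hG μ hfix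
  obtain ⟨M, hM⟩ := hX₀.exists
  have hae : ∀ᵐ N ∂μ, N ∈ MulAction.orbit G M := by
    filter_upwards [hX₀] with N hN using hX M hM N hN
  have heq : (MulAction.orbit G M : Set (RandomExpansion.Expansions G ι)) =ᵐ[μ] Set.univ :=
    Filter.eventuallyEq_univ.2 hae
  exact ⟨M, MeasurableSet.univ.nullMeasurableSet.congr heq.symm,
    by rw [measure_congr heq, measure_univ]⟩
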